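/- **Setting.** Let $P$ be the closed region bounded by a simple polygon, with a given triangulation $G$ whose vertices are exactly the vertices of the polygon; let $\mathbb H$ be a finite set of edges of $G$ (called diagonals; they may be internal or lie on the boundary), with one guard $g$ deployed on each diagonal $h_g\in\mathbb H$, let $l_g$ be the length of $h_g$, and let $r>0$ be the ratio of the maximum speed of the guards to that of the intruder. For $x,y\in P$ let $d(x,y)$ be the length of a shortest path from $x$ to $y$ in the visibility graph whose nodes are the vertices of $P$, $x$ and $y$, and put $d(A,B)=\inf_{p\in A,\,q\in B}d(p,q)$ ($=\infty$ if $A$ or $B$ is empty). A triangle of $G$ is *safe* if one of its edges is in $\mathbb H$. A guard is *incident* to a triangle $T$ if an endpoint of its diagonal is a vertex of $T$; $\mathbb G(T)$ is the set of guards incident to $T$. (A diagonal of a guard incident to a non-safe triangle $T$ has exactly one endpoint in $T$.) **Feasible allocations.** An allocation assigns to each non-safe triangle $T$ and each $g\in\mathbb G(T)$ a region $R_T(g)\subseteq T$. It is *feasible* if, for every non-safe $T$, the regions $R_T(g)$, $g\in\mathbb G(T)$, are pairwise disjoint with union $T$, and for every guard $g$, with diagonal $\{u,v\}$, the unions $U_u(g)$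 and $U_v(g)$ of the regions $R_T(g)$ over the non-safe triangles $T$ incident to $u$, respectively to $v$, satisfy $l_g/d(U_u(g),U_v(g))\le r$ (where $l_g/\infty=0$). **GENALLOC.** Initially no guard is allocated and no region is defined. An unallocated guard $g$ is *ready* at an endpoint $u$ of its diagonal if, for every non-safe triangle $T$ incident to $u$ and every $k\in\mathbb G(T)\setminus\{g\}$, the region $R^2_T(k)$ is already defined. While some guard is ready, one such guard $g$, with an endpoint $u$ at which it is ready, is chosen, and LOCALLOC is called. With $v$ the other endpoint of $h_g$, it does the following. * For each non-safe triangle $T$ incident to $u$ it defines $R^1_T(g)=T\setminus\bigcup_{k\in\mathbb G(T)\setminus\{g\}}R^2_T(k)$; let $\hat U$ be the union of these regions. * For each non-safe triangle $T$ incident to $v$ it defines $R^2_T(g)$ as the set of all points of $T$ not yet assigned to a guard whose distance from every point of $\hat U$ is at least $l_g/r$ (all unassigned points of $T$ if $\hat U=\emptyset$). If $R^2_T(k)$ is now defined for all $k\in\mathbb G(T)$ and these regions do not cover $T$, then GENALLOC halts and reports that no allocation is possible. Otherwise $g$ becomes allocated, and the loop continues. When no guard is ready, GENALLOC returns the allocation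 formed by the defined regions $R^1_T(g)$, $R^2_T(g)$ if all guards are allocated; if some guard is unallocated, it calls the subroutine ARBITALLOC. That subroutine picks an unallocated guard $g$ and an endpoint of its diagonal arbitrarily, and withdraws all other unallocated guards from the non-safe triangles incident to that endpoint, so that $g$ becomes ready; then the loop continues. **Lemma.** If ARBITALLOC is never called on a given input, then GENALLOC is complete for that input: if a feasible allocation exists, then every execution of GENALLOC (for any choice of the ready guards and endpoints), in which ARBITALLOC is not called, terminates and returns a feasible allocation. -/

import Mathlib

open Set
open scoped ENNReal

namespace GuardAlloc

/-- The plane, with its Euclidean distance. -/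
abbrev Pt : Type := EuclideanSpace ℝ (Fin 2)

/-! ### Simple polygons, triangulations and the shortest-path distance -/

/-- A simple polygon: at least three vertices, all distinct, and two different edges meet only in
common endpoints. -/
def IsSimple {n : ℕ} (poly : Polygon Pt n) : Prop :=
  3 ≤ n ∧ Function.Injective poly.vertices ∧
    ∀ i j : Fin n, i ≠ j → poly.edgeSet ℝ i ∩ poly.edgeSet ℝ j ⊆
      ({poly i, poly (finRotate n i)} : Set Pt) ∩ {poly j, poly (finRotate n j)}

/-- The closed region bounded by a polygon: its boundary, and all points whose connected component
in the complement of the boundary is bounded. -/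
def region {n : ℕ} (poly : Polygon Pt n) : Set Pt :=
  poly.boundary ℝ ∪
    {x | x ∉ poly.boundary ℝ ∧
      Bornology.IsBounded (connectedComponentIn (poly.boundary ℝ)ᶜ x)}

/-- `K` is a triangulation of the closed polygonal region, with no vertices other than those of the
polygon. Simplices are given by their finite sets of vertices. -/
def IsTriangulation {n : ℕ} (poly : Polygon Pt n) (K : Geometry.SimplicialComplex ℝ Pt) : Prop :=
  K.vertices = range poly.vertices ∧ K.space = region poly

/-- The visibility graph of the region `P` on the nodes `V ∪ {x, y}`. -/
def visGraph (P V : Set Pt) (x y : Pt) : SimpleGraph Pt where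
  Adj a b := a ≠ b ∧ a ∈ V ∪ {x, y} ∧ b ∈ V ∪ {x, y} ∧ segment ℝ a b ⊆ P
  symm := ⟨fun a b h => ⟨h.1.symm, h.2.2.1, h.2.1, segment_symm ℝ a b ▸ h.2.2.2⟩⟩
  loopless := ⟨fun _ h => h.1 rfl⟩

/-- The Euclidean length of a walk between points of the plane. -/
noncomputable def walkLength {G : SimpleGraph Pt} {x y : Pt} (w : G.Walk x y) : ℝ≥0∞ :=
  (w.darts.map fun e => edist e.fst e.snd).sum

/-! ### Inputs -/

/-- An input: a simple polygon, a triangulation of it, a set of diagonals (edges of the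
triangulation) on each of which one guard is deployed, and the speed ratio `r`.
Guards are identified with their diagonals, triangles and diagonals with their vertex sets. -/
structure Input (n : ℕ) where
  poly : Polygon Pt n
  simple : IsSimple poly
  K : Geometry.SimplicialComplex ℝ Pt
  triangulation : IsTriangulation poly K
  guards : Finset (Finset Pt)
  guards_edges : ∀ g ∈ guards, g ∈ K.faces ∧ g.card = 2
  r : ℝ
  r_pos : 0 < r

namespace Input

variable {n : ℕ} (I : Input n)

/-- The distance `d(x, y)`: length of a shortest path from `x` to `y` in the visibility graph on
the vertices of the polygon, `x` and `y`. -/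
noncomputable def dist (x y : Pt) : ℝ≥0∞ :=
  ⨅ w : (visGraph (region I.poly) (range I.poly.vertices) x y).Walk x y, walkLength w

/-- The distance between two sets of points (`⊤` when one of them is empty). -/
noncomputable def setDist (A B : Set Pt) : ℝ≥0∞ :=
  ⨅ q ∈ B, ⨅ p ∈ A, I.dist q p

/-- The triangles of the triangulation. -/
def triangles : Set (Finset Pt) := {T | T ∈ I.K.faces ∧ T.card = 3}

/-- Non-safe triangles: no guard is deployed on an edge of the triangle. -/
def nonSafe : Set (Finset Pt) := {T | T ∈ I.triangles ∧ ∀ g ∈ I.guards, ¬ g ⊆ T}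

/-- The guards incident to `T`: an endpoint of the diagonal is a vertex of `T`. -/
def incident (T : Finset Pt) : Set (Finset Pt) := {g | g ∈ I.guards ∧ ∃ x ∈ g, x ∈ T}

/-- The points of a triangle. -/
def pts (T : Finset Pt) : Set Pt := convexHull ℝ (T : Set Pt)

/-! ### Feasible allocations -/

/-- The union of the regions `A T g` over the non-safe triangles `T` incident to the endpoint `x`
of the diagonal `g`. -/
def endRegion (A : Finset Pt → Finset Pt → Set Pt) (g : Finset Pt) (x : Pt) : Set Pt :=
  ⋃ T ∈ {T | T ∈ I.nonSafe ∧ x ∈ T}, A T g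

/-- `A T g` is the region inside `T` allocated to the guard `g`. The allocation is feasible if the
regions of the incident guards partition every non-safe triangle, and every guard, with diagonal
`{u, v}`, has cost (length of the diagonal, divided by the distance between the two regions it
covers from `u` and from `v`) at most `r`. -/
def Feasible (A : Finset Pt → Finset Pt → Set Pt) : Prop :=
  (∀ T ∈ I.nonSafe, (⋃ g ∈ I.incident T, A T g) = pts T ∧ (I.incident T).PairwiseDisjoint (A T)) ∧
  ∀ u v : Pt, u ≠ v → {u, v} ∈ I.guards →
    edist u v / I.setDist (I.endRegion A {u, v} u) (I.endRegion A {u, v} v) ≤ ENNReal.ofReal I.r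

end Input

/-! ### The algorithm -/

/-- The data held by the algorithm.
* `inc T`: the guards that can still be allocated to `T`. It encodes the guard adjacency graph,
  which joins non-safe triangles `T`, `T'` incident to opposite endpoints of the diagonal `g` by an
  edge labelled `g`, present as long as `g ∈ inc T` and `g ∈ inc T'`. Deleting the edges at `T`
  labelled `g` is removing `g` from `inc T`.
* `pref g`: the preferential endpoint of `g` (the one labelled 1), once `g` is allocated.
* `R1 T g`, `R2 T g`: the region inside `T` allocated to `g`, when defined, according to whether
  `T` is incident to the endpoint of `g` labelled 1 or 2. -/
structure State where
  inc : Finset Pt → Set (Finset Pt)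
  pref : Finset Pt → Option Pt
  R1 : Finset Pt → Finset Pt → Option (Set Pt)
  R2 : Finset Pt → Finset Pt → Option (Set Pt)

/-- The region inside `T` allocated to `g` (empty if undefined). -/
def State.allocation (s : State) (T g : Finset Pt) : Set Pt :=
  ((s.R1 T g).or (s.R2 T g)).getD ∅

/-- Configurations: at the test of the main loop, calling ARBITALLOC, halted because LOCALLOC
found that no allocation is possible, and returned with an allocation. -/
inductive Config where
  | loop (s : State)
  | arbit (s : State)
  | failed (s : State)
  | returned (s : State)

namespace Input

variable {n : ℕ} (I : Input n)

/-- Initially all incident guards compete for a triangle, and nothing is allocated. -/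
def initState : State where
  inc := I.incident
  pref _ := none
  R1 _ _ := none
  R2 _ _ := none

/-- The non-safe triangles at the endpoint `x` of the diagonal of `g` for which `g` competes. -/
def trianglesAt (s : State) (g : Finset Pt) (x : Pt) : Set (Finset Pt) :=
  {T | T ∈ I.nonSafe ∧ x ∈ T ∧ g ∈ s.inc T}

/-- `g` is unallocated, and at every non-safe triangle incident to its endpoint `u`, the region
`R2` of every other guard is defined. -/
def ReadyAt (s : State) (g : Finset Pt) (u : Pt) : Prop :=
  g ∈ I.guards ∧ u ∈ g ∧ s.pref g = none ∧
    ∀ T ∈ I.trianglesAt s g u, ∀ k ∈ s.inc T, k ≠ g → (s.R2 T k).isSome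

/-- The guards ready to be allocated. -/
def ready (s : State) : Set (Finset Pt) := {g | ∃ u, I.ReadyAt s g u}

/-- The guards that are neither ready nor allocated. -/
def omega (s : State) : Set (Finset Pt) := {g | g ∈ I.guards ∧ s.pref g = none ∧ g ∉ I.ready s}

/-- The region given to `g` inside a triangle `T` at its preferential endpoint: what the regions
`R2` of the other guards leave of `T`. -/
def newR1 (s : State) (g T : Finset Pt) : Set Pt :=
  {p ∈ pts T | ∀ k ∈ s.inc T, k ≠ g → ∀ R ∈ s.R2 T k, p ∉ R}

/-- The union of the regions given to `g` at its preferential endpoint `u`. -/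
def newU1 (s : State) (g : Finset Pt) (u : Pt) : Set Pt :=
  ⋃ T ∈ I.trianglesAt s g u, newR1 s g T

/-- The part of `T` that has not been assigned to any guard. -/
def free (s : State) (T : Finset Pt) : Set Pt :=
  {p ∈ pts T | ∀ k, (∀ R ∈ s.R1 T k, p ∉ R) ∧ ∀ R ∈ s.R2 T k, p ∉ R}

/-- The region given to the guard on `{u, v}` inside a triangle `T` at the endpoint `v`, if `u` is
its preferential endpoint: the free points of `T` outside all open balls of radius
`length / r` centred in `newU1` (all the free points, if `newU1` is empty). -/
noncomputable def newR2 (s : State) (u v : Pt) (T : Finset Pt) : Set Pt :=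
  {q ∈ free s T | ∀ p ∈ I.newU1 s {u, v} u, ¬ I.dist p q < edist u v / ENNReal.ofReal I.r}

/-- LOCALLOC, called for the guard on `{u, v}` with preferential endpoint `u`. -/
noncomputable def localloc (s : State) (u v : Pt) : State :=
  open Classical in
  { inc := s.inc
    pref := fun g => if g = {u, v} then some u else s.pref g
    R1 := fun T g => if g = {u, v} ∧ T ∈ I.trianglesAt s {u, v} u then some (newR1 s {u, v} T)
      else s.R1 T g
    R2 := fun T g => if g = {u, v} ∧ T ∈ I.trianglesAt s {u, v} v then some (I.newR2 s u v T)
      else s.R2 T g }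

/-- The points of `T` that lie in no region `R2`. -/
def unassignable (s : State) (T : Finset Pt) : Set Pt :=
  {p ∈ pts T | ∀ k ∈ s.inc T, ∀ R ∈ s.R2 T k, p ∉ R}

/-- The value returned by LOCALLOC: at some triangle at the endpoint `v`, the regions `R2` of all
guards are now defined, and they do not cover the triangle. -/
def LocallocFails (s : State) (u v : Pt) : Prop :=
  ∃ T ∈ I.trianglesAt s {u, v} v,
    (∀ k ∈ s.inc T, ((I.localloc s u v).R2 T k).isSome) ∧
      (unassignable (I.localloc s u v) T).Nonempty

/-- ARBITALLOC, choosing the guard `g` and its endpoint `u`: at every non-safe triangle incident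
to `u`, the edges of the other guards of `omega` are deleted. -/
def arbitalloc (s : State) (g : Finset Pt) (u : Pt) : State :=
  { s with
    inc := fun T => {k | k ∈ s.inc T ∧ ¬ (T ∈ I.trianglesAt s g u ∧ k ∈ I.omega s ∧ k ≠ g)} }

/-- One step of GENALLOC. The choices of the guard and of the endpoint are nondeterministic. -/
inductive Step : Config → Config → Prop
  | allocate (s : State) (u v : Pt) (huv : u ≠ v) (h : I.ReadyAt s {u, v} u)
      (hfail : ¬ I.LocallocFails s u v) : Step (.loop s) (.loop (I.localloc s u v))
  | halt (s : State) (u v : Pt) (huv : u ≠ v) (h : I.ReadyAt s {u, v} u)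
      (hfail : I.LocallocFails s u v) : Step (.loop s) (.failed (I.localloc s u v))
  | callArbit (s : State) (h : I.ready s = ∅) (hΩ : (I.omega s).Nonempty) :
      Step (.loop s) (.arbit s)
  | arbit (s : State) (g : Finset Pt) (u : Pt) (hg : g ∈ I.omega s) (hu : u ∈ g) :
      Step (.arbit s) (.loop (I.arbitalloc s g u))
  | finish (s : State) (h : I.ready s = ∅) (hΩ : I.omega s = ∅) : Step (.loop s) (.returned s)

/-- An execution of GENALLOC, prolonged by repeating the last configuration once it has halted. -/
def IsExecution (e : ℕ → Config) : Prop :=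
  e 0 = .loop I.initState ∧
    ∀ t, I.Step (e t) (e (t + 1)) ∨ ((∀ c, ¬ I.Step (e t) c) ∧ e (t + 1) = e t)

end Input

end GuardAlloc

/-!
Fix a feasible allocation `A`. The point is that the algorithm is greedy in favour of `A`: whenever
some regions `R2 T k` of a triangle `T` are defined, together they contain every region `A T k` with
the same guards `k` (`Invariant.dominates`). Hence, when `g` is allocated, what the other regions
`R2` leave to it at its preferential endpoint is part of what `A` gives it there
(`Invariant.newR1_subset`). The points which `A` gives to `g` at the other endpoint are therefore far
enough from the new region of `g`, so `g` takes all of them that are still free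
(`Invariant.exists_mem_R2_of_mem_allocation`), and the domination persists.

If all guards of `T` have a region `R2`, then by domination these regions cover `T`, so the algorithm
never reports a failure. If some guard has a region `R1` inside `T`, this region is the complement of
the regions `R2` of all other guards. In both cases the regions in `T` form a partition, and the cost
bound holds because every region `R2` is chosen far from the regions `R1` of its guard. The number of
unallocated guards drops with every allocation, so an execution that never calls ARBITALLOC returns.
-/

namespace GuardAlloc

namespace Input

variable {n : ℕ} (I : Input n)

/-! ### The shortest-path distance -/

lemma visGraph_comm (P V : Set Pt) (x y : Pt) : visGraph P V x y = visGraph P V y x := by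
  ext a b
  simp only [visGraph, Set.pair_comm x y]

lemma walkLength_reverse {G : SimpleGraph Pt} {x y : Pt} (w : G.Walk x y) :
    walkLength w.reverse = walkLength w := by
  simp only [walkLength, SimpleGraph.Walk.darts_reverse, List.map_reverse, List.sum_reverse,
    List.map_map]
  congr 1
  refine List.map_congr_left fun d _ => ?_
  exact edist_comm _ _

lemma dist_comm (x y : Pt) : I.dist x y = I.dist y x := by
  have key : ∀ x y : Pt, I.dist x y ≤ I.dist y x := by
    intro x y
    unfold dist
    rw [visGraph_comm _ _ x y]
    exact le_iInf fun w => (iInf_le _ w.reverse).trans (walkLength_reverse w).le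
  exact le_antisymm (key x y) (key y x)

lemma le_setDist_iff {c : ℝ≥0∞} {B C : Set Pt} :
    c ≤ I.setDist B C ↔ ∀ p ∈ B, ∀ q ∈ C, c ≤ I.dist p q := by
  simp only [setDist, le_iInf_iff]
  exact ⟨fun h p hp q hq => I.dist_comm q p ▸ h q hq p hp,
    fun h q hq p hp => I.dist_comm p q ▸ h p hp q hq⟩

lemma setDist_comm (B C : Set Pt) : I.setDist B C = I.setDist C B := by
  refine eq_of_forall_le_iff fun c => ?_
  rw [le_setDist_iff, le_setDist_iff]
  exact ⟨fun h p hp q hq => I.dist_comm q p ▸ h q hq p hp,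
    fun h p hp q hq => I.dist_comm q p ▸ h q hq p hp⟩

/-- The cost bound is a lower bound on the distance between the two regions, because `0 < r < ∞`. -/
lemma cost_le_iff {l d : ℝ≥0∞} :
    l / d ≤ ENNReal.ofReal I.r ↔ l / ENNReal.ofReal I.r ≤ d := by
  have h0 : ENNReal.ofReal I.r ≠ 0 := (ENNReal.ofReal_pos.2 I.r_pos).ne'
  have ht : ENNReal.ofReal I.r ≠ ∞ := ENNReal.ofReal_ne_top
  rw [ENNReal.div_le_iff_le_mul (.inr ht) (.inr h0), ENNReal.div_le_iff_le_mul (.inl h0) (.inl ht),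
    mul_comm]

/-! ### Triangles and guards -/

variable {I}

lemma mem_incident_left {u v : Pt} {T : Finset Pt} (hg : {u, v} ∈ I.guards) (hu : u ∈ T) :
    {u, v} ∈ I.incident T := ⟨hg, u, by simp, hu⟩

lemma mem_incident_right {u v : Pt} {T : Finset Pt} (hg : {u, v} ∈ I.guards) (hv : v ∈ T) :
    {u, v} ∈ I.incident T := ⟨hg, v, by simp, hv⟩

/-- A non-safe triangle contains at most one endpoint of a diagonal with a guard. -/
lemma notMem_of_nonSafe {u v : Pt} {T : Finset Pt} (hg : {u, v} ∈ I.guards) (hT : T ∈ I.nonSafe)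
    (hu : u ∈ T) : v ∉ T := fun hv =>
  hT.2 _ hg (by simp [Finset.insert_subset_iff, hu, hv])

lemma Feasible.exists_mem {A : Finset Pt → Finset Pt → Set Pt} (hA : I.Feasible A) {T : Finset Pt}
    (hT : T ∈ I.nonSafe) {p : Pt} (hp : p ∈ pts T) : ∃ k ∈ I.incident T, p ∈ A T k := by
  rw [← (hA.1 T hT).1] at hp
  simpa using hp

lemma Feasible.subset_pts {A : Finset Pt → Finset Pt → Set Pt} (hA : I.Feasible A) {T g : Finset Pt}
    (hT : T ∈ I.nonSafe) (hg : g ∈ I.incident T) : A T g ⊆ pts T := by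
  rw [← (hA.1 T hT).1]
  exact subset_biUnion_of_mem (u := A T) hg

lemma mem_endRegion {A : Finset Pt → Finset Pt → Set Pt} {g : Finset Pt} {x p : Pt} :
    p ∈ I.endRegion A g x ↔ ∃ T ∈ I.nonSafe, x ∈ T ∧ p ∈ A T g := by
  simp [endRegion, and_assoc]

/-! ### The invariant of the main loop -/

/-- What holds at every test of the main loop before any call of ARBITALLOC, for a fixed feasible
allocation `A`. -/
structure Invariant (I : Input n) (A : Finset Pt → Finset Pt → Set Pt) (s : State) : Prop where
  inc_eq : s.inc = I.incident
  /-- A region `R1` lies at the preferential endpoint of its guard, and it is what the regions `R2`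
  of all other guards, which are defined, leave of the triangle. -/
  of_R1 : ∀ T g R, s.R1 T g = some R → (∃ u ∈ T, s.pref g = some u) ∧
    (∀ k ∈ I.incident T, k ≠ g → (s.R2 T k).isSome) ∧ R = newR1 s g T
  /-- A region `R2` lies at the endpoint of its guard that is not preferential. -/
  of_R2 : ∀ T g R, s.R2 T g = some R →
    T ∈ I.nonSafe ∧ g ∈ I.incident T ∧ (∃ u ∉ T, s.pref g = some u) ∧ R ⊆ pts T
  disjoint_R2 : ∀ T g k R R', g ≠ k → s.R2 T g = some R → s.R2 T k = some R' → Disjoint R R'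
  dominates : ∀ T k, (s.R2 T k).isSome → ∀ p ∈ A T k, ∃ k' R, s.R2 T k' = some R ∧ p ∈ R
  /-- An allocated guard has regions in all non-safe triangles at its endpoints, and those at
  opposite endpoints are far from each other. -/
  of_pref : ∀ g u, s.pref g = some u → ∃ v, u ≠ v ∧ g = {u, v} ∧
    (∀ T ∈ I.nonSafe, u ∈ T → (s.R1 T g).isSome) ∧
    (∀ T ∈ I.nonSafe, v ∈ T → (s.R2 T g).isSome) ∧
    ∀ T T' R R', s.R1 T g = some R → s.R2 T' g = some R' → ∀ p ∈ R, ∀ q ∈ R',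
      edist u v / ENNReal.ofReal I.r ≤ I.dist p q

lemma invariant_initState (A : Finset Pt → Finset Pt → Set Pt) : Invariant I A I.initState := by
  constructor <;> simp [initState]

namespace Invariant

variable {A : Finset Pt → Finset Pt → Set Pt} {s : State} {u v : Pt}

lemma R1_eq_none (h : Invariant I A s) {g : Finset Pt} (hg : s.pref g = none) (T : Finset Pt) :
    s.R1 T g = none := by
  rw [Option.eq_none_iff_forall_ne_some]
  intro R hR
  obtain ⟨⟨u, -, hu⟩, -⟩ := h.of_R1 T g R hR
  simp [hg] at hu

lemma R2_eq_none (h : Invariant I A s) {g : Finset Pt} (hg : s.pref g = none) (T : Finset Pt) :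
    s.R2 T g = none := by
  rw [Option.eq_none_iff_forall_ne_some]
  intro R hR
  obtain ⟨-, -, ⟨u, -, hu⟩, -⟩ := h.of_R2 T g R hR
  simp [hg] at hu

lemma mem_trianglesAt_left (h : Invariant I A s) (hg : {u, v} ∈ I.guards) {T : Finset Pt} :
    T ∈ I.trianglesAt s {u, v} u ↔ T ∈ I.nonSafe ∧ u ∈ T := by
  simp only [trianglesAt, mem_ofPred_eq, h.inc_eq]
  exact ⟨fun h => ⟨h.1, h.2.1⟩, fun h => ⟨h.1, h.2, mem_incident_left hg h.2⟩⟩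

lemma mem_trianglesAt_right (h : Invariant I A s) (hg : {u, v} ∈ I.guards) {T : Finset Pt} :
    T ∈ I.trianglesAt s {u, v} v ↔ T ∈ I.nonSafe ∧ v ∈ T := by
  rw [Finset.pair_comm] at hg ⊢
  exact h.mem_trianglesAt_left hg

/-- At its preferential endpoint a ready guard gets no more than the feasible allocation gives
it. -/
lemma newR1_subset (h : Invariant I A s) (hA : I.Feasible A) (hr : I.ReadyAt s {u, v} u)
    {T : Finset Pt} (hT : T ∈ I.trianglesAt s {u, v} u) : newR1 s {u, v} T ⊆ A T {u, v} := by
  rintro p ⟨hp, hp'⟩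
  obtain ⟨k, hk, hpk⟩ := hA.exists_mem hT.1 hp
  by_cases hkg : k = {u, v}
  · exact hkg ▸ hpk
  · obtain ⟨k', R, hR, hpR⟩ :=
      h.dominates T k (hr.2.2.2 T hT k (h.inc_eq ▸ hk) hkg) p hpk
    refine absurd hpR (hp' k' ?_ ?_ R hR)
    · exact h.inc_eq ▸ (h.of_R2 T k' R hR).2.1
    · rintro rfl
      simp [h.R2_eq_none hr.2.2.1] at hR

/-- Domination for the guard being allocated: what the feasible allocation gives it at its other
endpoint is either taken already or far enough to be taken now. -/
lemma exists_mem_R2_of_mem_allocation (h : Invariant I A s) (hA : I.Feasible A) (huv : u ≠ v)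
    (hr : I.ReadyAt s {u, v} u) {T : Finset Pt} (hT : T ∈ I.trianglesAt s {u, v} v) {p : Pt}
    (hp : p ∈ A T {u, v}) : (∃ k R, s.R2 T k = some R ∧ p ∈ R) ∨ p ∈ I.newR2 s u v T := by
  have hg : {u, v} ∈ I.guards := hr.1
  have hTi : {u, v} ∈ I.incident T := mem_incident_right hg hT.2.1
  refine or_iff_not_imp_left.2 fun hno => ⟨⟨hA.subset_pts hT.1 hTi hp, fun k => ⟨?_, ?_⟩⟩, ?_⟩
  · -- A region `R1` in `T` would require the region `R2` of the unallocated guard `{u, v}`.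
    intro R hR
    have hk : {u, v} ≠ k := by
      rintro rfl
      simp [h.R1_eq_none hr.2.2.1] at hR
    have := (h.of_R1 T k R hR).2.1 _ hTi hk
    simp [h.R2_eq_none hr.2.2.1] at this
  · exact fun R hR hpR => hno ⟨k, R, hR, hpR⟩
  · intro q hq
    simp only [newU1, mem_iUnion] at hq
    obtain ⟨T', hT', hq⟩ := hq
    have hqA := h.newR1_subset hA hr hT' hq
    exact not_lt.2 <| I.le_setDist_iff.1 (I.cost_le_iff.1 (hA.2 u v huv hg)) q
      (mem_endRegion.2 ⟨T', hT'.1, hT'.2.1, hqA⟩) p (mem_endRegion.2 ⟨T, hT.1, hT.2.1, hp⟩)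

end Invariant

section Localloc

variable {A : Finset Pt → Finset Pt → Set Pt} {s : State} {u v : Pt} {T g : Finset Pt}

lemma localloc_pref_self : (I.localloc s u v).pref {u, v} = some u := by simp [localloc]

lemma localloc_pref_of_ne (hg : g ≠ {u, v}) : (I.localloc s u v).pref g = s.pref g := by
  simp [localloc, hg]

lemma localloc_R1_of_ne (hg : g ≠ {u, v}) : (I.localloc s u v).R1 T g = s.R1 T g := by
  simp [localloc, hg]

lemma localloc_R2_of_ne (hg : g ≠ {u, v}) : (I.localloc s u v).R2 T g = s.R2 T g := by
  simp [localloc, hg]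

lemma Invariant.localloc_R1_self_iff (h : Invariant I A s) (hr : I.ReadyAt s {u, v} u)
    {R : Set Pt} : (I.localloc s u v).R1 T {u, v} = some R ↔
      T ∈ I.trianglesAt s {u, v} u ∧ newR1 s {u, v} T = R := by
  by_cases hT : T ∈ I.trianglesAt s {u, v} u <;>
    simp [localloc, hT, h.R1_eq_none hr.2.2.1]

lemma Invariant.localloc_R2_self_iff (h : Invariant I A s) (hr : I.ReadyAt s {u, v} u)
    {R : Set Pt} : (I.localloc s u v).R2 T {u, v} = some R ↔
      T ∈ I.trianglesAt s {u, v} v ∧ I.newR2 s u v T = R := by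
  by_cases hT : T ∈ I.trianglesAt s {u, v} v <;>
    simp [localloc, hT, h.R2_eq_none hr.2.2.1]

lemma Invariant.localloc_R2_of_some (h : Invariant I A s) (hr : I.ReadyAt s {u, v} u)
    {R : Set Pt} (hR : s.R2 T g = some R) : (I.localloc s u v).R2 T g = some R := by
  rwa [localloc_R2_of_ne]
  rintro rfl
  simp [h.R2_eq_none hr.2.2.1] at hR

/-- Once the regions `R2` of the other guards are defined, later allocations do not change what they
leave to `g`. -/
lemma Invariant.newR1_localloc (h : Invariant I A s) (hr : I.ReadyAt s {u, v} u)
    (hsome : ∀ k ∈ I.incident T, k ≠ g → (s.R2 T k).isSome) :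
    newR1 (I.localloc s u v) g T = newR1 s g T := by
  have hR2 : ∀ k ∈ s.inc T, k ≠ g → (I.localloc s u v).R2 T k = s.R2 T k := by
    intro k hk hkg
    obtain ⟨R, hR⟩ := Option.isSome_iff_exists.1 (hsome k (h.inc_eq ▸ hk) hkg)
    rw [hR, h.localloc_R2_of_some hr hR]
  ext p
  refine and_congr_right fun _ => forall₃_congr fun k hk hkg => ?_
  rw [hR2 k hk hkg]

lemma disjoint_newR2 {R : Set Pt} (hR : s.R2 T g = some R) : Disjoint R (I.newR2 s u v T) :=
  Set.disjoint_left.2 fun _ hp hq => (hq.1.2 g).2 R hR hp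

theorem Invariant.localloc (h : Invariant I A s) (hA : I.Feasible A) (huv : u ≠ v)
    (hr : I.ReadyAt s {u, v} u) : Invariant I A (I.localloc s u v) where
  inc_eq := h.inc_eq
  of_R1 T g R hR := by
    by_cases hg : g = {u, v}
    · subst hg
      obtain ⟨hT, rfl⟩ := (h.localloc_R1_self_iff hr).1 hR
      have hsome : ∀ k ∈ I.incident T, k ≠ {u, v} → (s.R2 T k).isSome :=
        fun k hk => hr.2.2.2 T hT k (h.inc_eq ▸ hk)
      refine ⟨⟨u, hT.2.1, localloc_pref_self⟩, fun k hk hkg => ?_, (h.newR1_localloc hr hsome).symm⟩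
      rw [localloc_R2_of_ne hkg]
      exact hsome k hk hkg
    · rw [localloc_R1_of_ne hg] at hR
      obtain ⟨h1, h2, h3⟩ := h.of_R1 T g R hR
      refine ⟨by rwa [localloc_pref_of_ne hg], fun k hk hkg => ?_, ?_⟩
      · obtain ⟨R', hR'⟩ := Option.isSome_iff_exists.1 (h2 k hk hkg)
        rw [h.localloc_R2_of_some hr hR', Option.isSome_some]
      · rw [h.newR1_localloc hr h2, h3]
  of_R2 T g R hR := by
    by_cases hg : g = {u, v}
    · subst hg
      obtain ⟨hT, rfl⟩ := (h.localloc_R2_self_iff hr).1 hR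
      exact ⟨hT.1, mem_incident_right hr.1 hT.2.1,
        ⟨u, fun hu => notMem_of_nonSafe hr.1 hT.1 hu hT.2.1, localloc_pref_self⟩,
        fun p hp => hp.1.1⟩
    · rw [localloc_R2_of_ne hg] at hR
      rw [localloc_pref_of_ne hg]
      exact h.of_R2 T g R hR
  disjoint_R2 T g k R R' hgk hR hR' := by
    by_cases hg : g = {u, v}
    · subst hg
      obtain ⟨-, rfl⟩ := (h.localloc_R2_self_iff hr).1 hR
      rw [localloc_R2_of_ne hgk.symm] at hR'
      exact (disjoint_newR2 hR').symm
    · rw [localloc_R2_of_ne hg] at hR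
      by_cases hk : k = {u, v}
      · subst hk
        obtain ⟨-, rfl⟩ := (h.localloc_R2_self_iff hr).1 hR'
        exact disjoint_newR2 hR
      · rw [localloc_R2_of_ne hk] at hR'
        exact h.disjoint_R2 T g k R R' hgk hR hR'
  dominates T k hk p hp := by
    have hold : (∃ k' R, s.R2 T k' = some R ∧ p ∈ R) →
        ∃ k' R, (I.localloc s u v).R2 T k' = some R ∧ p ∈ R :=
      fun ⟨k', R, hR, hpR⟩ => ⟨k', R, h.localloc_R2_of_some hr hR, hpR⟩
    by_cases hkg : k = {u, v}
    · subst hkg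
      obtain ⟨R, hR⟩ := Option.isSome_iff_exists.1 hk
      obtain ⟨hT, rfl⟩ := (h.localloc_R2_self_iff hr).1 hR
      exact (h.exists_mem_R2_of_mem_allocation hA huv hr hT hp).elim hold
        fun hp' => ⟨_, _, hR, hp'⟩
    · rw [localloc_R2_of_ne hkg] at hk
      exact hold (h.dominates T k hk p hp)
  of_pref g w hw := by
    by_cases hg : g = {u, v}
    · subst hg
      obtain rfl : u = w := by simpa [localloc_pref_self] using hw
      refine ⟨v, huv, rfl, fun T hT hu => ?_, fun T hT hv => ?_, fun T T' R R' hR hR' p hp q hq => ?_⟩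
      · exact Option.isSome_iff_exists.2
          ⟨_, (h.localloc_R1_self_iff hr).2 ⟨(h.mem_trianglesAt_left hr.1).2 ⟨hT, hu⟩, rfl⟩⟩
      · exact Option.isSome_iff_exists.2
          ⟨_, (h.localloc_R2_self_iff hr).2 ⟨(h.mem_trianglesAt_right hr.1).2 ⟨hT, hv⟩, rfl⟩⟩
      · obtain ⟨hT, rfl⟩ := (h.localloc_R1_self_iff hr).1 hR
        obtain ⟨hT', rfl⟩ := (h.localloc_R2_self_iff hr).1 hR'
        exact not_lt.1 (hq.2 p (mem_biUnion hT hp))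
    · rw [localloc_pref_of_ne hg] at hw
      simp only [localloc_R1_of_ne hg, localloc_R2_of_ne hg]
      exact h.of_pref g w hw

end Localloc

namespace Invariant

variable {A : Finset Pt → Finset Pt → Set Pt} {s : State} {u v : Pt}

/-- If all guards of a triangle have a region `R2` there, these regions cover it. -/
lemma exists_mem_R2 (h : Invariant I A s) (hA : I.Feasible A) {T : Finset Pt} (hT : T ∈ I.nonSafe)
    (hsome : ∀ k ∈ I.incident T, (s.R2 T k).isSome) {p : Pt} (hp : p ∈ pts T) :
    ∃ k ∈ I.incident T, ∃ R, s.R2 T k = some R ∧ p ∈ R := by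
  obtain ⟨k, hk, hpk⟩ := hA.exists_mem hT hp
  obtain ⟨k', R, hR, hpR⟩ := h.dominates T k (hsome k hk) p hpk
  exact ⟨k', (h.of_R2 T k' R hR).2.1, R, hR, hpR⟩

lemma not_locallocFails (h : Invariant I A s) (hA : I.Feasible A) (huv : u ≠ v)
    (hr : I.ReadyAt s {u, v} u) : ¬ I.LocallocFails s u v := by
  rintro ⟨T, hT, hsome, p, hp, hp'⟩
  have h' := h.localloc hA huv hr
  obtain ⟨k, hk, R, hR, hpR⟩ := h'.exists_mem_R2 hA hT.1 (fun k hk => hsome k (h.inc_eq ▸ hk)) hp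
  exact hp' k (h'.inc_eq ▸ hk) R hR hpR

/-! ### The returned allocation -/

lemma allocation_of_R1 {T g : Finset Pt} {R : Set Pt} (hR : s.R1 T g = some R) :
    s.allocation T g = R := by
  simp [State.allocation, hR]

lemma allocation_of_R2 (h : Invariant I A s) {T g : Finset Pt} {R : Set Pt}
    (hR : s.R2 T g = some R) : s.allocation T g = R := by
  have h1 : s.R1 T g = none := by
    rw [Option.eq_none_iff_forall_ne_some]
    intro R' hR'
    obtain ⟨⟨x, hx, hxg⟩, -⟩ := h.of_R1 T g R' hR'
    obtain ⟨-, -, ⟨y, hy, hyg⟩, -⟩ := h.of_R2 T g R hR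
    rw [hxg, Option.some_inj] at hyg
    exact hy (hyg ▸ hx)
  simp [State.allocation, h1, hR]

/-- In a triangle at an endpoint of an allocated guard exactly one of the regions `R1`, `R2` of the
guard is defined, and this is the one that counts in the returned allocation. -/
lemma exists_R1_or_R2 (h : Invariant I A s) {T g : Finset Pt} (hT : T ∈ I.nonSafe)
    (hg : g ∈ I.incident T) (hpref : s.pref g ≠ none) :
    s.R1 T g = some (s.allocation T g) ∨ s.R2 T g = some (s.allocation T g) := by
  obtain ⟨u, hu⟩ := Option.ne_none_iff_exists'.1 hpref
  obtain ⟨v, -, rfl, h1, h2, -⟩ := h.of_pref g u hu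
  obtain ⟨-, x, hx, hxT⟩ := hg
  rw [Finset.mem_insert, Finset.mem_singleton] at hx
  obtain rfl | rfl := hx
  · obtain ⟨R, hR⟩ := Option.isSome_iff_exists.1 (h1 T hT hxT)
    exact .inl (by rw [allocation_of_R1 hR, hR])
  · obtain ⟨R, hR⟩ := Option.isSome_iff_exists.1 (h2 T hT hxT)
    exact .inr (by rw [h.allocation_of_R2 hR, hR])

lemma iUnion_allocation (h : Invariant I A s) (hA : I.Feasible A)
    (hall : ∀ g ∈ I.guards, s.pref g ≠ none) {T : Finset Pt} (hT : T ∈ I.nonSafe) :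
    ⋃ g ∈ I.incident T, s.allocation T g = pts T := by
  refine Subset.antisymm (iUnion₂_subset fun g hg => ?_) fun p hp => ?_
  · obtain hR | hR := h.exists_R1_or_R2 hT hg (hall g hg.1)
    · rw [(h.of_R1 T g _ hR).2.2]
      exact fun p hp => hp.1
    · exact (h.of_R2 T g _ hR).2.2.2
  · simp only [mem_iUnion]
    by_cases hR1 : ∃ g ∈ I.incident T, s.R1 T g = some (s.allocation T g)
    · obtain ⟨g, hg, hR⟩ := hR1
      by_cases hpg : p ∈ s.allocation T g
      · exact ⟨g, hg, hpg⟩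
      · rw [(h.of_R1 T g _ hR).2.2] at hpg
        have : ∃ k ∈ s.inc T, k ≠ g ∧ ∃ R, s.R2 T k = some R ∧ p ∈ R := by
          by_contra! hno
          exact hpg ⟨hp, fun k hk hkg R hR => hno k hk hkg R hR⟩
        obtain ⟨k, hk, -, R, hR, hpR⟩ := this
        exact ⟨k, h.inc_eq ▸ hk, by rwa [h.allocation_of_R2 hR]⟩
    · push Not at hR1
      have hsome : ∀ k ∈ I.incident T, (s.R2 T k).isSome := fun k hk => by
        rw [(h.exists_R1_or_R2 hT hk (hall k hk.1)).resolve_left (hR1 k hk), Option.isSome_some]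
      obtain ⟨k, hk, R, hR, hpR⟩ := h.exists_mem_R2 hA hT hsome hp
      exact ⟨k, hk, by rwa [h.allocation_of_R2 hR]⟩

lemma pairwiseDisjoint_allocation (h : Invariant I A s)
    (hall : ∀ g ∈ I.guards, s.pref g ≠ none) {T : Finset Pt} (hT : T ∈ I.nonSafe) :
    (I.incident T).PairwiseDisjoint (s.allocation T) := by
  have hR1 : ∀ g k R R', k ∈ I.incident T → k ≠ g → s.R1 T g = some R → s.R2 T k = some R' →
      Disjoint R R' := by
    intro g k R R' hk hkg hR hR'
    rw [(h.of_R1 T g R hR).2.2]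
    exact Set.disjoint_left.2 fun p hp => hp.2 k (h.inc_eq ▸ hk) hkg R' hR'
  intro g hg k hk hgk
  obtain hRg | hRg := h.exists_R1_or_R2 hT hg (hall g hg.1) <;>
    obtain hRk | hRk := h.exists_R1_or_R2 hT hk (hall k hk.1)
  · -- Two guards cannot both have a region `R1` in `T`: each needs the other to have a region `R2`.
    obtain ⟨R, hR⟩ := Option.isSome_iff_exists.1 ((h.of_R1 T g _ hRg).2.1 k hk hgk.symm)
    obtain ⟨⟨x, hx, hxk⟩, -⟩ := h.of_R1 T k _ hRk
    obtain ⟨-, -, ⟨y, hy, hyk⟩, -⟩ := h.of_R2 T k R hR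
    rw [hxk, Option.some_inj] at hyk
    exact absurd (hyk ▸ hx) hy
  · exact hR1 g k _ _ hk hgk.symm hRg hRk
  · exact (hR1 k g _ _ hg hgk hRk hRg).symm
  · exact h.disjoint_R2 T g k _ _ hgk hRg hRk

/-- The cost bound for an allocated guard, at its preferential endpoint `u`. -/
lemma cost_allocation_le (h : Invariant I A s) (hg : {u, v} ∈ I.guards)
    (hu : s.pref {u, v} = some u) :
    edist u v / I.setDist (I.endRegion s.allocation {u, v} u) (I.endRegion s.allocation {u, v} v) ≤
      ENNReal.ofReal I.r := by
  obtain ⟨w, huw, hgw, h1, h2, hd⟩ := h.of_pref _ u hu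
  obtain rfl : w = v := by
    have : w ∈ ({u, v} : Finset Pt) := hgw ▸ by simp
    simpa [huw.symm] using this
  refine I.cost_le_iff.2 (I.le_setDist_iff.2 fun p hp q hq => ?_)
  obtain ⟨T, hT, huT, hp⟩ := mem_endRegion.1 hp
  obtain ⟨T', hT', hvT', hq⟩ := mem_endRegion.1 hq
  obtain ⟨R, hR⟩ := Option.isSome_iff_exists.1 (h1 T hT huT)
  obtain ⟨R', hR'⟩ := Option.isSome_iff_exists.1 (h2 T' hT' hvT')
  rw [allocation_of_R1 hR] at hp
  rw [h.allocation_of_R2 hR'] at hq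
  exact hd T T' R R' hR hR' p hp q hq

theorem feasible_allocation (h : Invariant I A s) (hA : I.Feasible A)
    (hall : ∀ g ∈ I.guards, s.pref g ≠ none) : I.Feasible s.allocation := by
  refine ⟨fun T hT => ⟨h.iUnion_allocation hA hall hT, h.pairwiseDisjoint_allocation hall hT⟩,
    fun u v huv hg => ?_⟩
  obtain ⟨x, hx⟩ := Option.ne_none_iff_exists'.1 (hall _ hg)
  obtain ⟨y, -, hxy, -⟩ := h.of_pref _ x hx
  have hxm : x ∈ ({u, v} : Finset Pt) := hxy ▸ by simp
  rw [Finset.mem_insert, Finset.mem_singleton] at hxm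
  obtain rfl | rfl := hxm
  · exact h.cost_allocation_le hg hx
  · rw [Finset.pair_comm] at hg hx ⊢
    rw [edist_comm, setDist_comm]
    exact h.cost_allocation_le hg hx

end Invariant

/-! ### Termination -/

/-- The guards that are not allocated yet. -/
noncomputable def unallocated (I : Input n) (s : State) : Finset (Finset Pt) :=
  open Classical in I.guards.filter fun g => s.pref g = none

lemma card_unallocated_localloc_lt {s : State} {u v : Pt} (hr : I.ReadyAt s {u, v} u) :
    (I.unallocated (I.localloc s u v)).card < (I.unallocated s).card := by
  classical
  refine Finset.card_lt_card (Finset.ssubset_iff_of_subset ?_ |>.2 ⟨{u, v}, ?_, ?_⟩)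
  · intro g hg
    simp only [unallocated, Finset.mem_filter] at hg ⊢
    have hne : g ≠ {u, v} := by
      rintro rfl
      simp [localloc_pref_self] at hg
    rwa [localloc_pref_of_ne hne] at hg
  · simp [unallocated, hr.1, hr.2.2.1]
  · simp [unallocated, localloc_pref_self]

/-- The main loop never gets stuck. -/
lemma exists_step_loop (I : Input n) (s : State) : ∃ c, I.Step (.loop s) c := by
  rcases (I.ready s).eq_empty_or_nonempty with h | ⟨g, u, hr⟩
  · rcases (I.omega s).eq_empty_or_nonempty with hΩ | hΩ
    · exact ⟨_, .finish s h hΩ⟩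
    · exact ⟨_, .callArbit s h hΩ⟩
  · obtain ⟨a, b, hab, rfl⟩ := Finset.card_eq_two.1 (I.guards_edges g hr.1).2
    obtain ⟨v, huv, hg⟩ : ∃ v, u ≠ v ∧ ({a, b} : Finset Pt) = {u, v} := by
      have hu := hr.2.1
      rw [Finset.mem_insert, Finset.mem_singleton] at hu
      obtain rfl | rfl := hu
      · exact ⟨b, hab, rfl⟩
      · exact ⟨a, hab.symm, Finset.pair_comm _ _⟩
    rw [hg] at hr
    by_cases hf : I.LocallocFails s u v
    · exact ⟨_, .halt s u v huv hr hf⟩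
    · exact ⟨_, .allocate s u v huv hr hf⟩

theorem exists_returned_feasible {A : Finset Pt → Finset Pt → Set Pt} (hA : I.Feasible A)
    {e : ℕ → Config} (he : I.IsExecution e) (hArbit : ∀ t s, e t ≠ .arbit s) (t : ℕ) (s : State)
    (ht : e t = .loop s) (h : Invariant I A s) :
    ∃ t s, e t = .returned s ∧ I.Feasible s.allocation := by
  induction hm : (I.unallocated s).card using Nat.strong_induction_on generalizing t s with
  | _ m ih =>
    subst hm
    have hstep : I.Step (e t) (e (t + 1)) := by
      refine (he.2 t).resolve_right fun hstuck => ?_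
      obtain ⟨c, hc⟩ := I.exists_step_loop s
      exact hstuck.1 c (ht ▸ hc)
    rw [ht] at hstep
    generalize hc : e (t + 1) = c at hstep
    cases hstep with
    | allocate _ u v huv hr hf =>
      exact ih _ (card_unallocated_localloc_lt hr) (t + 1) _ hc (h.localloc hA huv hr) rfl
    | halt _ u v huv hr hf => exact absurd hf (h.not_locallocFails hA huv hr)
    | callArbit _ hr hΩ => exact absurd hc (hArbit _ _)
    | finish _ hr hΩ =>
      refine ⟨t + 1, s, hc, h.feasible_allocation hA fun g hg hpref => ?_⟩
      have hmem : g ∈ I.omega s := ⟨hg, hpref, by simp [hr]⟩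
      simp [hΩ] at hmem

end Input

end GuardAlloc

theorem mainTheorem3 {n : ℕ} (I : GuardAlloc.Input n)
    (e : ℕ → GuardAlloc.Config) (he : I.IsExecution e)
    (hArbit : ∀ t s, e t ≠ GuardAlloc.Config.arbit s)
    (hFeasible : ∃ A : Finset GuardAlloc.Pt → Finset GuardAlloc.Pt → Set GuardAlloc.Pt,
      I.Feasible A) :
    ∃ t s, e t = GuardAlloc.Config.returned s ∧ I.Feasible s.allocation := by
  obtain ⟨A, hA⟩ := hFeasible
  exact GuardAlloc.Input.exists_returned_feasible hA he hArbit 0 _ he.1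
    (GuardAlloc.Input.invariant_initState A)
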